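/- Let $X$ be a separable reflexive Banach space over $\mathbb R$ or $\mathbb C$, written as a topological direct sum $X=Y\oplus Z$ of closed linear subspaces. Let $G\leqslant \mathrm{GL}(X)$ be a subgroup of the group of continuous linear automorphisms of $X$ that is bounded, i.e. $\sup_{T\in G}\|T\|<\infty$, and leaves $Y$ invariant. Assume that (i) there is no closed linear $G$-invariant subspace $W$ with $\{0\}\subsetneq W\subsetneq Y$ and none with $Y\subsetneq W\subsetneq X$; (ii) there is no closed linear $G$-invariant complement of $Y$ in $X$. Then, with respect to $X=Y\oplus Z$, every $T\in G$ is given by a block matrix $$T=\begin{pmatrix} u & \delta(u,v)\\ 0 & v\end{pmatrix},$$ where $u\in \mathrm{GL}(Y)$, $v\in\mathrm{GL}(Z)$, and $\delta(u,v)\colon Z\to Y$ is a bounded linear operator that depends only on $u$ and $v$. Let $U\leqslant\mathrm{GL}(Y)$ and $V\leqslant \mathrm{GL}(Z)$ be the subgroups of all $u$, respectively all $v$, that occur in the block matrices of elements of $G$. With the strong operator topology (sot), i.e. the topology of pointwise convergence in norm, $G$, $U$ and $V$ are topological groups, and the mappings $$\begin{pmatrix} u & \delta(u,v)\\ 0 &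 v\end{pmatrix}\mapsto u\qquad\text{and}\qquad \begin{pmatrix} u & \delta(u,v)\\ 0 & v\end{pmatrix}\mapsto v$$ are isomorphisms of topological groups from $(G,\mathrm{sot})$ onto $(U,\mathrm{sot})$ and from $(G,\mathrm{sot})$ onto $(V,\mathrm{sot})$, respectively. -/

import Mathlib

namespace BlockSOT

section Basic

variable {𝕜 E : Type*} [RCLike 𝕜] [NormedAddCommGroup E] [NormedSpace 𝕜 E]

variable (𝕜 E) in
/-- A normed space is reflexive if the canonical map into its bidual is surjective. -/
def IsReflexiveSpace : Prop :=
  Function.Surjective (NormedSpace.inclusionInDoubleDual 𝕜 E)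

/-- A subgroup of `GL(E)` is bounded if its elements are uniformly bounded in operator norm. -/
def IsBoundedGroup (G : Subgroup (E ≃L[𝕜] E)) : Prop :=
  ∃ C : ℝ, ∀ T ∈ G, ‖(T : E →L[𝕜] E)‖ ≤ C

/-- `W` is invariant under every element of `G`. -/
def IsInvariantUnder (G : Subgroup (E ≃L[𝕜] E)) (W : Submodule 𝕜 E) : Prop :=
  ∀ T ∈ G, ∀ x ∈ W, T x ∈ W

/-- The strong operator topology (topology of pointwise convergence) on a subgroup of `GL(E)`. -/
abbrev sot (G : Subgroup (E ≃L[𝕜] E)) : TopologicalSpace G :=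
  TopologicalSpace.induced
    (fun T : G => (((T : E ≃L[𝕜] E) : E →L[𝕜] E).toPointwiseConvergenceCLM 𝕜 (RingHom.id 𝕜) E E :
      E →Lₚₜ[𝕜] E)) inferInstance

/-- Convergence in `sot G` is pointwise convergence in norm. -/
theorem tendsto_sot_iff (G : Subgroup (E ≃L[𝕜] E)) {ι : Type*} {p : Filter ι} {a : ι → G} {T : G} :
    Filter.Tendsto a p (@nhds G (sot G) T) ↔
      ∀ x : E, Filter.Tendsto (fun i => (a i : E ≃L[𝕜] E) x) p (nhds ((T : E ≃L[𝕜] E) x)) := by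
  rw [nhds_induced, Filter.tendsto_comap_iff, PointwiseConvergenceCLM.tendsto_iff_forall_tendsto]
  rfl

/-- `G` with the strong operator topology is a topological group. -/
def IsSOTTopologicalGroup (G : Subgroup (E ≃L[𝕜] E)) : Prop :=
  @IsTopologicalGroup G (sot G) _

/-- A group isomorphism that is a homeomorphism for the strong operator topologies. -/
def IsSOTIsomorphism {F : Type*} [NormedAddCommGroup F] [NormedSpace 𝕜 F]
    {G : Subgroup (E ≃L[𝕜] E)} {H : Subgroup (F ≃L[𝕜] F)} (φ : G ≃* H) : Prop :=
  @IsHomeomorph G H (sot G) (sot H) φ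

end Basic

section Blocks

variable {𝕜 X : Type*} [RCLike 𝕜] [NormedAddCommGroup X] [NormedSpace 𝕜 X]
  {Y Z : Submodule 𝕜 X}

/-- With respect to `X = Y ⊕ Z`, the operator `T` has the block matrix `(u, w; 0, v)`. -/
def HasBlockForm (T : X ≃L[𝕜] X) (u : Y ≃L[𝕜] Y) (w : Z →L[𝕜] Y) (v : Z ≃L[𝕜] Z) : Prop :=
  ∀ (y : Y) (z : Z), T ((y : X) + (z : X)) = ((u y + w z : Y) : X) + (v z : X)

theorem HasBlockForm.one :
    HasBlockForm (1 : X ≃L[𝕜] X) (1 : Y ≃L[𝕜] Y) (0 : Z →L[𝕜] Y) (1 : Z ≃L[𝕜] Z) := by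
  intro y z
  change (y : X) + (z : X) = ((y + (0 : Z →L[𝕜] Y) z : Y) : X) + (z : X)
  simp

theorem HasBlockForm.mul {T₁ T₂ : X ≃L[𝕜] X} {u₁ u₂ : Y ≃L[𝕜] Y} {w₁ w₂ : Z →L[𝕜] Y}
    {v₁ v₂ : Z ≃L[𝕜] Z} (h₁ : HasBlockForm T₁ u₁ w₁ v₁) (h₂ : HasBlockForm T₂ u₂ w₂ v₂) :
    HasBlockForm (T₁ * T₂) (u₁ * u₂)
      ((u₁ : Y →L[𝕜] Y).comp w₂ + w₁.comp (v₂ : Z →L[𝕜] Z)) (v₁ * v₂) := by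
  intro y z
  have h : (T₁ * T₂) ((y : X) + (z : X)) = T₁ (T₂ ((y : X) + (z : X))) := rfl
  rw [h, h₂ y z, h₁]
  have hu : (u₁ * u₂) y = u₁ (u₂ y) := rfl
  have hv : (v₁ * v₂) z = v₁ (v₂ z) := rfl
  simp [hu, hv, add_assoc]

theorem HasBlockForm.inv {T : X ≃L[𝕜] X} {u : Y ≃L[𝕜] Y} {w : Z →L[𝕜] Y}
    {v : Z ≃L[𝕜] Z} (h : HasBlockForm T u w v) :
    HasBlockForm T⁻¹ u⁻¹
      (-((u.symm : Y →L[𝕜] Y).comp (w.comp (v.symm : Z →L[𝕜] Z)))) v⁻¹ := by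
  intro y z
  have h1 : (T⁻¹ : X ≃L[𝕜] X) = T.symm := rfl
  have h2 : (u⁻¹ : Y ≃L[𝕜] Y) = u.symm := rfl
  have h3 : (v⁻¹ : Z ≃L[𝕜] Z) = v.symm := rfl
  rw [h1, h2, h3, ContinuousLinearEquiv.symm_apply_eq, h]
  simp

/-- The block entries of an operator are uniquely determined. -/
theorem HasBlockForm.unique (hYZ : IsCompl Y Z) {T : X ≃L[𝕜] X} {u u' : Y ≃L[𝕜] Y}
    {w w' : Z →L[𝕜] Y} {v v' : Z ≃L[𝕜] Z} (h : HasBlockForm T u w v)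
    (h' : HasBlockForm T u' w' v') : u = u' ∧ w = w' ∧ v = v' := by
  have key : ∀ (y : Y) (z : Z), u y + w z = u' y + w' z ∧ v z = v' z := by
    intro y z
    have e := (h y z).symm.trans (h' y z)
    have e2 : (((u y + w z) - (u' y + w' z) : Y) : X) = ((v' z - v z : Z) : X) := by
      push_cast at e ⊢
      rw [sub_eq_sub_iff_add_eq_add, e]
      abel
    have e3 := Submodule.disjoint_def.1 hYZ.disjoint _ (Subtype.coe_prop _)
      (by rw [e2]; exact Subtype.coe_prop _)
    have e4 := e2.symm.trans e3
    constructor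
    · exact sub_eq_zero.1 (Subtype.ext e3)
    · exact (sub_eq_zero.1 (Subtype.ext e4)).symm
  refine ⟨?_, ?_, ?_⟩
  · ext y
    simpa using congrArg Subtype.val (key y 0).1
  · ext z
    simpa using congrArg Subtype.val (key 0 z).1
  · ext z
    exact congrArg Subtype.val (key 0 z).2

variable (Y Z) in
/-- The group `U` of all `u ∈ GL(Y)` that occur as the upper left block of an element of `G`. -/
def upperBlocks (G : Subgroup (X ≃L[𝕜] X)) : Subgroup (Y ≃L[𝕜] Y) where
  carrier := {u | ∃ (v : Z ≃L[𝕜] Z) (w : Z →L[𝕜] Y), ∃ T ∈ G, HasBlockForm T u w v}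
  one_mem' := ⟨1, 0, 1, G.one_mem, HasBlockForm.one⟩
  mul_mem' := by
    rintro _ _ ⟨_, _, _, hT₁, h₁⟩ ⟨_, _, _, hT₂, h₂⟩
    exact ⟨_, _, _, G.mul_mem hT₁ hT₂, h₁.mul h₂⟩
  inv_mem' := by
    rintro _ ⟨_, _, _, hT, h⟩
    exact ⟨_, _, _, G.inv_mem hT, h.inv⟩

variable (Y Z) in
/-- The group `V` of all `v ∈ GL(Z)` that occur as the lower right block of an element of `G`. -/
def lowerBlocks (G : Subgroup (X ≃L[𝕜] X)) : Subgroup (Z ≃L[𝕜] Z) where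
  carrier := {v | ∃ (u : Y ≃L[𝕜] Y) (w : Z →L[𝕜] Y), ∃ T ∈ G, HasBlockForm T u w v}
  one_mem' := ⟨1, 0, 1, G.one_mem, HasBlockForm.one⟩
  mul_mem' := by
    rintro _ _ ⟨_, _, _, hT₁, h₁⟩ ⟨_, _, _, hT₂, h₂⟩
    exact ⟨_, _, _, G.mul_mem hT₁ hT₂, h₁.mul h₂⟩
  inv_mem' := by
    rintro _ ⟨_, _, _, hT, h⟩
    exact ⟨_, _, _, G.inv_mem hT, h.inv⟩

end Blocks

end BlockSOT

/-! The point is that T → 1 in `G`, T → 1 on `Y`, and T → 1 modulo `Y` are the same thing. Pull the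
neighbourhoods of 1 in `U` or `V` back to a filter `𝓕` on `G`; it is invariant under conjugation.
Let `𝒮` be the set of weak operator limits of `G` along ultrafilters finer than `𝓕`. An
Alaoglu–Birkhoff decomposition (`isCompl_fixedSpace_displacementSpace`) splits `X` into the common
fixed space of `𝒮` and its displacement space; both are closed and, by conjugation invariance,
`G`-invariant.

For `U`, the fixed space contains `Y`. By maximality it is `Y` or `X`, and it cannot be `Y`, since
the displacement space would be an invariant complement. For `V`, the displacement space lies in
`Y`. By minimality it is `Y` or 0, and it cannot be `Y`, since the fixed space would be an invariant
complement. Either way 1 is the only limit operator, so T → 1 weakly.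

Passing from weak to strong convergence (`WeakTendsto.tendsto_of_orbit`) rests on small slices of
weakly compact sets (`IsWeaklyCompact.exists_small_slice`). The same slices show that a point which
is the mean of its images under limit operators is fixed by each of them, which yields the
decomposition. Injectivity of both block maps is the case of principal filters, and `δ` exists by
injectivity. -/

open Filter Topology

namespace BlockSOT

/-! ### Weak convergence, reflexivity and separability of the dual -/

section WeakConvergence

variable {𝕜 E : Type*} [RCLike 𝕜] [NormedAddCommGroup E] [NormedSpace 𝕜 E]

variable (𝕜) in
/-- Weak convergence of a family along a filter. -/
def WeakTendsto {ι : Type*} (x : ι → E) (p : Filter ι) (a : E) : Prop :=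
  ∀ f : StrongDual 𝕜 E, Tendsto (fun i => f (x i)) p (𝓝 (f a))

theorem WeakTendsto.eq {ι : Type*} {x : ι → E} {p : Filter ι} [p.NeBot] {a b : E}
    (ha : WeakTendsto 𝕜 x p a) (hb : WeakTendsto 𝕜 x p b) : a = b :=
  (SeparatingDual.eq_iff_forall_dual_eq (R := 𝕜)).2 fun f => tendsto_nhds_unique (ha f) (hb f)

theorem WeakTendsto.map {ι F : Type*} [NormedAddCommGroup F] [NormedSpace 𝕜 F] {x : ι → E}
    {p : Filter ι} {a : E} (h : WeakTendsto 𝕜 x p a) (S : E →L[𝕜] F) :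
    WeakTendsto 𝕜 (fun i => S (x i)) p (S a) :=
  fun f => h (f.comp S)

theorem WeakTendsto.of_tendsto {ι : Type*} {x : ι → E} {p : Filter ι} {a : E}
    (h : Tendsto x p (𝓝 a)) : WeakTendsto 𝕜 x p a :=
  fun f => (f.continuous.tendsto a).comp h

theorem WeakTendsto.sub {ι : Type*} {x y : ι → E} {p : Filter ι} {a b : E}
    (ha : WeakTendsto 𝕜 x p a) (hb : WeakTendsto 𝕜 y p b) :
    WeakTendsto 𝕜 (fun i => x i - y i) p (a - b) :=
  fun f => by simpa using (ha f).sub (hb f)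

theorem WeakTendsto.norm_le {ι : Type*} {x : ι → E} {p : Filter ι} [p.NeBot] {a : E} {C : ℝ}
    (h : WeakTendsto 𝕜 x p a) (hC : ∀ᶠ i in p, ‖x i‖ ≤ C) : ‖a‖ ≤ C := by
  have hC0 : 0 ≤ C := by
    obtain ⟨i, hi⟩ := hC.exists
    exact (norm_nonneg _).trans hi
  refine NormedSpace.norm_le_dual_bound 𝕜 a hC0 fun f => ?_
  refine le_of_tendsto (h f).norm (hC.mono fun i hi => ?_)
  rw [mul_comm]
  exact f.le_opNorm_of_le hi

/-- In a reflexive space, bounded families converge weakly along ultrafilters. -/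
theorem IsReflexiveSpace.exists_weakTendsto (hE : IsReflexiveSpace 𝕜 E) {ι : Type*}
    (p : Ultrafilter ι) {x : ι → E} {C : ℝ} (hC : ∀ᶠ i in (p : Filter ι), ‖x i‖ ≤ C) :
    ∃ a, WeakTendsto 𝕜 x p a := by
  have key : ∀ f : StrongDual 𝕜 E, ∃ l : 𝕜, Tendsto (fun i => f (x i)) p (𝓝 l) := by
    intro f
    have hmem : Metric.closedBall (0 : 𝕜) (‖f‖ * C) ∈ p.map (fun i => f (x i)) :=
      hC.mono fun i hi => by
        simpa using f.le_opNorm_of_le hi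
    obtain ⟨l, -, hl⟩ := (isCompact_closedBall (0 : 𝕜) (‖f‖ * C)).ultrafilter_le_nhds' _ hmem
    exact ⟨l, hl⟩
  choose l hl using key
  -- The limits of `f (x i)` are linear and bounded in `f`, hence an element of the bidual, which
  -- reflexivity represents by a point.
  let L : StrongDual 𝕜 E →ₗ[𝕜] 𝕜 :=
    { toFun := l
      map_add' := fun f g => tendsto_nhds_unique (hl (f + g)) ((hl f).add (hl g))
      map_smul' := fun c f => tendsto_nhds_unique (hl (c • f)) ((hl f).const_smul c) }
  have hL : ∀ f, ‖L f‖ ≤ C * ‖f‖ := fun f =>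
    le_of_tendsto (hl f).norm (hC.mono fun i hi => by
      rw [mul_comm]; exact f.le_opNorm_of_le hi)
  obtain ⟨a, ha⟩ := hE (L.mkContinuous C hL)
  refine ⟨a, fun f => ?_⟩
  have : f a = l f := by
    rw [← NormedSpace.dual_def 𝕜 E a f, ha]
    rfl
  rw [this]
  exact hl f

/-- Evaluations at points exhaust the bidual, so a functional on the bidual is determined by its
restriction to them. -/
theorem IsReflexiveSpace.dual (hE : IsReflexiveSpace 𝕜 E) :
    IsReflexiveSpace 𝕜 (StrongDual 𝕜 E) := by
  intro φ
  refine ⟨φ.comp (NormedSpace.inclusionInDoubleDual 𝕜 E), ?_⟩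
  ext F
  obtain ⟨x, rfl⟩ := hE F
  simp [NormedSpace.dual_def]

/-- A normed space with separable dual is separable. -/
theorem separableSpace_of_separableSpace_dual
    [TopologicalSpace.SeparableSpace (StrongDual 𝕜 E)] : TopologicalSpace.SeparableSpace E := by
  let φ : ℕ → StrongDual 𝕜 E := TopologicalSpace.denseSeq _
  have hx : ∀ n, ∃ x : E, ‖x‖ ≤ 1 ∧ ‖φ n‖ / 2 ≤ ‖φ n x‖ := by
    intro n
    by_cases h0 : ‖φ n‖ = 0
    · exact ⟨0, by simp, by simp [h0]⟩
    · obtain ⟨x, hx, hlt⟩ := (φ n).exists_lt_apply_of_lt_opNorm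
        (half_lt_self ((norm_nonneg _).lt_of_ne' h0))
      exact ⟨x, hx.le, hlt.le⟩
  choose x hx1 hx2 using hx
  let M : Submodule 𝕜 E := (Submodule.span 𝕜 (Set.range x)).topologicalClosure
  have hM : IsClosed (M : Set E) := Submodule.isClosed_topologicalClosure _
  have hsep : TopologicalSpace.IsSeparable (M : Set E) := by
    rw [Submodule.topologicalClosure_coe]
    exact ((Set.countable_range x).isSeparable.span (R := 𝕜)).closure
  suffices hT : M = ⊤ by
    rw [hT] at hsep
    exact TopologicalSpace.isSeparable_univ_iff.1 (by simpa using hsep)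
  by_contra hne
  obtain ⟨z, -, hz⟩ := SetLike.exists_of_lt (lt_top_iff_ne_top.2 hne)
  have hz' : (M.mkQ z : E ⧸ M) ≠ 0 := by simpa using hz
  obtain ⟨g, hg⟩ : ∃ g : StrongDual 𝕜 (E ⧸ M), g (M.mkQ z) ≠ 0 := by
    by_contra! h
    exact hz' ((SeparatingDual.eq_zero_iff_forall_dual_eq_zero (R := 𝕜) _).2 h)
  let f : StrongDual 𝕜 E := g.comp M.mkQL
  have hfz : f z ≠ 0 := hg
  have hfx : ∀ n, f (x n) = 0 := by
    intro n
    have hm : x n ∈ M := Submodule.le_topologicalClosure _ (Submodule.subset_span ⟨n, rfl⟩)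
    change g (M.mkQ (x n)) = 0
    rw [show M.mkQ (x n) = 0 from (Submodule.Quotient.mk_eq_zero M).2 hm, map_zero]
  have hf : 0 < ‖f‖ := norm_pos_iff.2 fun h => hfz (by rw [h]; rfl)
  -- Since `f` kills `x n`, ‖φ n‖/2 ≤ ‖(f - φ n) (x n)‖ < ‖f‖/4, whereas closeness to `f` forces ‖φ
  -- n‖ > 3‖f‖/4.
  obtain ⟨n, hn⟩ := (TopologicalSpace.denseRange_denseSeq (StrongDual 𝕜 E)).exists_dist_lt f
    (show 0 < ‖f‖ / 4 by positivity)
  rw [dist_eq_norm] at hn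
  have h1 : ‖(f - φ n) (x n)‖ ≤ ‖f - φ n‖ * 1 := (f - φ n).le_opNorm_of_le (hx1 n)
  have h2 : ‖(f - φ n) (x n)‖ = ‖φ n (x n)‖ := by
    rw [sub_apply, hfx, zero_sub, norm_neg]
  have h3 : ‖f‖ ≤ ‖f - φ n‖ + ‖φ n‖ := by simpa using norm_add_le (f - φ n) (φ n)
  have h4 := hx2 n
  change ‖f - φ n‖ < _ at hn
  linarith

end WeakConvergence

/-! ### Small slices of weakly compact sets, by Baire category -/

section Slices

variable {𝕜 E : Type*} [RCLike 𝕜] [NormedAddCommGroup E] [NormedSpace 𝕜 E]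

variable (𝕜) in
/-- Every ultrafilter on `K` converges weakly to a point of `K`. -/
def IsWeaklyCompact (K : Set E) : Prop :=
  ∀ p : Ultrafilter E, K ∈ p → ∃ a ∈ K, WeakTendsto 𝕜 id p a

theorem IsWeaklyCompact.exists_weakTendsto {K : Set E} (hK : IsWeaklyCompact 𝕜 K) {ι : Type*}
    (p : Ultrafilter ι) {x : ι → E} (hx : ∀ᶠ i in (p : Filter ι), x i ∈ K) :
    ∃ a ∈ K, WeakTendsto 𝕜 x p a :=
  hK (p.map x) hx

/-- A functional attains its maximum on a nonempty bounded weakly compact set. -/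
theorem IsWeaklyCompact.exists_forall_re_le {K : Set E} (hK : IsWeaklyCompact 𝕜 K)
    (hne : K.Nonempty) {R : ℝ} (hR : ∀ x ∈ K, ‖x‖ ≤ R) (f : StrongDual 𝕜 E) :
    ∃ x ∈ K, ∀ y ∈ K, RCLike.re (f y) ≤ RCLike.re (f x) := by
  let s : Set ℝ := (fun y => RCLike.re (f y)) '' K
  have hb : BddAbove s := by
    refine ⟨‖f‖ * R, ?_⟩
    rintro _ ⟨y, hy, rfl⟩
    exact (RCLike.re_le_norm _).trans (f.le_opNorm_of_le (hR y hy))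
  obtain ⟨u, -, hu, hus⟩ := exists_seq_tendsto_sSup (hne.image _) hb
  choose x hxK hxu using hus
  obtain ⟨a, haK, ha⟩ := hK.exists_weakTendsto (hyperfilter ℕ) (Eventually.of_forall hxK)
  refine ⟨a, haK, fun y hy => ?_⟩
  have h1 : Tendsto u (hyperfilter ℕ : Filter ℕ) (𝓝 (RCLike.re (f a))) := by
    rw [← funext hxu]
    exact (RCLike.continuous_re.tendsto _).comp (ha f)
  rw [tendsto_nhds_unique h1 (hu.mono_left Nat.hyperfilter_le_atTop)]
  exact le_csSup hb ⟨y, hy, rfl⟩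

/-- Weakly compact subsets of a separable space have slices of arbitrarily small diameter. -/
theorem IsWeaklyCompact.exists_small_slice [TopologicalSpace.SeparableSpace E]
    {K : Set E} (hK : IsWeaklyCompact 𝕜 K) (hne : K.Nonempty) {R : ℝ} (hR : ∀ x ∈ K, ‖x‖ ≤ R)
    {ε : ℝ} (hε : 0 < ε) :
    ∃ (f : StrongDual 𝕜 E) (c : E) (a : ℝ), (∃ x ∈ K, a < RCLike.re (f x)) ∧
      ∀ x ∈ K, a < RCLike.re (f x) → ‖x - c‖ ≤ ε := by
  let c : ℕ → E := TopologicalSpace.denseSeq E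
  -- Functionals whose maximum over `K` is attained within `ε / 2` of `c n`. These sets are closed
  -- by weak compactness and cover the dual, so by Baire one of them contains a ball.
  let A : ℕ → Set (StrongDual 𝕜 E) := fun n =>
    {f | ∃ x ∈ K, ‖x - c n‖ ≤ ε / 2 ∧ ∀ y ∈ K, RCLike.re (f y) ≤ RCLike.re (f x)}
  have hA : ∀ n, IsClosed (A n) := by
    intro n
    rw [isClosed_iff_ultrafilter]
    intro f p hpf hp
    have : ∀ g : StrongDual 𝕜 E, ∃ x, g ∈ A n → (x ∈ K ∧ ‖x - c n‖ ≤ ε / 2 ∧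
        ∀ y ∈ K, RCLike.re (g y) ≤ RCLike.re (g x)) := by
      intro g
      by_cases hg : g ∈ A n
      · obtain ⟨x, hx⟩ := hg
        exact ⟨x, fun _ => hx⟩
      · exact ⟨0, fun h => (hg h).elim⟩
    choose x hx using this
    have hp' : ∀ᶠ g in (p : Filter _), g ∈ A n := hp
    obtain ⟨a, haK, ha⟩ := hK.exists_weakTendsto p (x := x) (hp'.mono fun g hg => (hx g hg).1)
    refine ⟨a, haK, ?_, fun y hy => ?_⟩
    · exact (ha.sub (.of_tendsto tendsto_const_nhds)).norm_le (hp'.mono fun g hg => (hx g hg).2.1)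
    · have hid : Tendsto (fun g : StrongDual 𝕜 E => g) p (𝓝 f) := hpf
      have h1 : Tendsto (fun g : StrongDual 𝕜 E => RCLike.re (g y)) p (𝓝 (RCLike.re (f y))) :=
        (RCLike.continuous_re.tendsto _).comp
          (((ContinuousLinearMap.apply 𝕜 𝕜 y).continuous.tendsto f).comp hid)
      have h2 : Tendsto (fun g : StrongDual 𝕜 E => (g - f) (x g)) p (𝓝 0) := by
        have h3 : Tendsto (fun g : StrongDual 𝕜 E => ‖g - f‖ * R) p (𝓝 0) := by
          simpa using ((hid.sub_const f).norm).mul_const R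
        refine squeeze_zero_norm' (hp'.mono fun g hg => ?_) h3
        exact (g - f).le_opNorm_of_le (hR _ (hx g hg).1)
      have h3 : Tendsto (fun g : StrongDual 𝕜 E => RCLike.re (g (x g))) p
          (𝓝 (RCLike.re (f a))) := by
        have := (RCLike.continuous_re.tendsto _).comp (h2.add (ha f))
        simpa [Function.comp_def] using this
      exact le_of_tendsto_of_tendsto h1 h3 (hp'.mono fun g hg => (hx g hg).2.2 y hy)
  have hU : ⋃ n, A n = Set.univ := by
    refine Set.eq_univ_of_forall fun f => Set.mem_iUnion.2 ?_
    obtain ⟨x, hxK, hx⟩ := hK.exists_forall_re_le hne hR f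
    obtain ⟨n, hn⟩ := (TopologicalSpace.denseRange_denseSeq E).exists_dist_lt x (half_pos hε)
    exact ⟨n, x, hxK, by rw [← dist_eq_norm]; exact hn.le, hx⟩
  obtain ⟨n, f, hf⟩ := nonempty_interior_of_iUnion_of_closed hA hU
  obtain ⟨r, hr, hball⟩ := Metric.isOpen_iff.1 isOpen_interior f hf
  obtain ⟨x₀, hx₀K, -, hx₀⟩ := interior_subset hf
  -- If `x` in this slice were farther than `ε` from `c n`, adding `r / 2` times a norming
  -- functional of `x - c n` to `f` would stay in `A n`. At `x` the added term exceeds its value at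
  -- any point within `ε / 2` of `c n` by more than `r * ε / 4`, the depth of the slice, so no such
  -- point could be a maximum.
  refine ⟨f, c n, RCLike.re (f x₀) - r * ε / 4, ⟨x₀, hx₀K, by linarith [mul_pos hr hε]⟩,
    fun x hxK hx => ?_⟩
  by_contra! hlt
  obtain ⟨g, hg1, hg⟩ := exists_dual_vector'' 𝕜 (x - c n)
  have hmem : f + ((r / 2 : ℝ) : 𝕜) • g ∈ Metric.ball f r := by
    rw [mem_ball_iff_norm, add_sub_cancel_left, norm_smul, RCLike.norm_ofReal,
      abs_of_pos (half_pos hr)]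
    nlinarith
  obtain ⟨z, hzK, hzc, hz⟩ := interior_subset (hball hmem)
  have h1 := hz x hxK
  simp only [add_apply, smul_apply, map_add, smul_eq_mul,
    RCLike.re_ofReal_mul] at h1
  have h2 := hx₀ z hzK
  have h3 : RCLike.re (g x) = ‖x - c n‖ + RCLike.re (g (c n)) := by
    have := congrArg RCLike.re hg
    rw [map_sub, map_sub, RCLike.ofReal_re] at this
    linarith
  have h4 : RCLike.re (g z) ≤ ε / 2 + RCLike.re (g (c n)) := by
    have h5 : RCLike.re (g (z - c n)) ≤ 1 * (ε / 2) :=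
      (RCLike.re_le_norm _).trans (g.le_of_opNorm_le_of_le hg1 hzc)
    rw [map_sub, map_sub] at h5
    linarith
  have h5 : r / 2 * RCLike.re (g x) > r / 2 * RCLike.re (g z) + r / 2 * (ε / 2) := by
    rw [← mul_add]
    exact mul_lt_mul_of_pos_left (by linarith) (half_pos hr)
  linarith

end Slices

/-! ### Orbit hulls and rigidity of limit operators -/

section LimitOperators

variable {𝕜 E Γ : Type*} [RCLike 𝕜] [NormedAddCommGroup E] [NormedSpace 𝕜 E] [Group Γ]

/-- The weakly closed (real) convex hull of the orbit of `x`, as an intersection of half-spaces. -/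
def orbitHull (ρ : Γ →* (E →L[𝕜] E)) (x : E) : Set E :=
  {y | ∀ (f : StrongDual 𝕜 E) (c : ℝ), (∀ γ, RCLike.re (f (ρ γ x)) ≤ c) → RCLike.re (f y) ≤ c}

/-- `S` is a limit of operators `ρ γ` in the weak operator topology. -/
def IsLimitOperator (ρ : Γ →* (E →L[𝕜] E)) (S : E →L[𝕜] E) : Prop :=
  ∃ p : Ultrafilter Γ, ∀ x, WeakTendsto 𝕜 (fun γ => ρ γ x) p (S x)

variable {ρ : Γ →* (E →L[𝕜] E)}

theorem orbit_mem_orbitHull (γ : Γ) (x : E) : ρ γ x ∈ orbitHull ρ x :=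
  fun _ _ h => h γ

theorem self_mem_orbitHull (x : E) : x ∈ orbitHull ρ x := by
  simpa using orbit_mem_orbitHull (ρ := ρ) 1 x

theorem map_mem_orbitHull {x y : E} (hy : y ∈ orbitHull ρ x) (γ : Γ) :
    ρ γ y ∈ orbitHull ρ x := fun f c h =>
  hy (f.comp (ρ γ)) c fun γ' => by simpa using h (γ * γ')

theorem orbitHull_closed {ι : Type*} {p : Filter ι} [p.NeBot] {x a : E} {y : ι → E}
    (ha : WeakTendsto 𝕜 y p a) (hy : ∀ᶠ i in p, y i ∈ orbitHull ρ x) : a ∈ orbitHull ρ x :=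
  fun f c h => le_of_tendsto ((RCLike.continuous_re.tendsto _).comp (ha f))
    (hy.mono fun _ hi => hi f c h)

theorem IsLimitOperator.map_mem_orbitHull {S : E →L[𝕜] E} (hS : IsLimitOperator ρ S) (x : E) :
    S x ∈ orbitHull ρ x := by
  obtain ⟨p, hp⟩ := hS
  exact orbitHull_closed (hp x) (Eventually.of_forall fun γ => orbit_mem_orbitHull γ x)

variable {C : ℝ}

theorem norm_le_of_mem_orbitHull (hC : ∀ γ, ‖ρ γ‖ ≤ C) {x y : E} (hy : y ∈ orbitHull ρ x) :
    ‖y‖ ≤ C * ‖x‖ := by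
  obtain ⟨g, hg1, hg⟩ := exists_dual_vector'' 𝕜 y
  have := hy g (C * ‖x‖) fun γ => (RCLike.re_le_norm _).trans <| by
    simpa using g.le_of_opNorm_le_of_le hg1 ((ρ γ).le_of_opNorm_le (hC γ) x)
  rwa [hg, RCLike.ofReal_re] at this

theorem norm_le_mul_norm_map (hC : ∀ γ, ‖ρ γ‖ ≤ C) (γ : Γ) (z : E) : ‖z‖ ≤ C * ‖ρ γ z‖ := by
  have : ρ γ⁻¹ (ρ γ z) = z := by
    rw [← mul_apply_eq_comp, ← map_mul]
    simp
  simpa [this] using (ρ γ⁻¹).le_of_opNorm_le (hC γ⁻¹) (ρ γ z)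

theorem isWeaklyCompact_orbitHull (hE : IsReflexiveSpace 𝕜 E) (hC : ∀ γ, ‖ρ γ‖ ≤ C) (x : E) :
    IsWeaklyCompact 𝕜 (orbitHull ρ x) := by
  intro p hp
  obtain ⟨a, ha⟩ := hE.exists_weakTendsto p (x := id) (C := C * ‖x‖)
    (Eventually.mono hp fun y hy => norm_le_of_mem_orbitHull hC hy)
  exact ⟨a, orbitHull_closed ha hp, ha⟩

/-- Some point of the orbit of `x` lies in a slice of the orbit hull of small diameter. -/
theorem exists_slice_orbitHull [TopologicalSpace.SeparableSpace E] (hE : IsReflexiveSpace 𝕜 E)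
    (hC : ∀ γ, ‖ρ γ‖ ≤ C) (x : E) {ε : ℝ} (hε : 0 < ε) :
    ∃ (γ : Γ) (f : StrongDual 𝕜 E) (a : ℝ), a < RCLike.re (f (ρ γ x)) ∧
      ∀ y ∈ orbitHull ρ x, a < RCLike.re (f y) → ‖y - ρ γ x‖ ≤ ε := by
  obtain ⟨f, c, a, ⟨y, hy, hay⟩, hsl⟩ := (isWeaklyCompact_orbitHull hE hC x).exists_small_slice
    ⟨x, self_mem_orbitHull x⟩ (fun y hy => norm_le_of_mem_orbitHull hC hy) (half_pos hε)
  -- A half-space containing the whole orbit contains the hull, so a nonempty slice of the hull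
  -- meets the orbit.
  obtain ⟨γ, hγ⟩ : ∃ γ, a < RCLike.re (f (ρ γ x)) := by
    by_contra! h
    exact absurd (hy f a h) (not_le.2 hay)
  refine ⟨γ, f, a, hγ, fun z hz haz => ?_⟩
  have h1 := hsl z hz haz
  have h2 := hsl _ (orbit_mem_orbitHull γ x) hγ
  calc ‖z - ρ γ x‖ = ‖(z - c) - (ρ γ x - c)‖ := by rw [sub_sub_sub_cancel_right]
    _ ≤ ‖z - c‖ + ‖ρ γ x - c‖ := norm_sub_le _ _
    _ ≤ ε := by linarith

/-- For orbits of bounded groups on separable reflexive spaces, weak convergence to the base point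
is norm convergence. -/
theorem WeakTendsto.tendsto_of_orbit [TopologicalSpace.SeparableSpace E]
    (hE : IsReflexiveSpace 𝕜 E) (hC : ∀ γ, ‖ρ γ‖ ≤ C) {ι : Type*} {p : Filter ι} {γ : ι → Γ}
    {x : E} (h : WeakTendsto 𝕜 (fun i => ρ (γ i) x) p x) :
    Tendsto (fun i => ρ (γ i) x) p (𝓝 x) := by
  rw [Metric.tendsto_nhds]
  intro ε hε
  -- `|C| + 1` serves as a positive divisor in place of `C`, which may be 0. It pays for undoing `ρ
  -- g` after estimating inside the slice.
  have hC1 : 0 < |C| + 1 := by positivity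
  obtain ⟨g, f, a, hg, hsl⟩ := exists_slice_orbitHull hE hC x
    (show 0 < ε / (2 * (|C| + 1)) by positivity)
  have h1 : Tendsto (fun i => RCLike.re (f (ρ g (ρ (γ i) x)))) p (𝓝 (RCLike.re (f (ρ g x)))) :=
    (RCLike.continuous_re.tendsto _).comp (h.map (ρ g) f)
  filter_upwards [h1.eventually (lt_mem_nhds hg)] with i hi
  have h2 := (hsl _ (BlockSOT.map_mem_orbitHull (orbit_mem_orbitHull (γ i) x) g) hi)
  rw [← map_sub] at h2
  rw [dist_eq_norm]
  calc ‖ρ (γ i) x - x‖ ≤ C * ‖ρ g (ρ (γ i) x - x)‖ := norm_le_mul_norm_map hC g _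
    _ ≤ (|C| + 1) * (ε / (2 * (|C| + 1))) :=
        mul_le_mul ((le_abs_self C).trans (by linarith)) h2 (norm_nonneg _) hC1.le
    _ = ε / 2 := by field_simp
    _ < ε := half_lt_self hε

/-- If a point is the average of its images under limit operators of a bounded group on a
separable reflexive space, then it is fixed by all of them. -/
theorem fixed_of_sum_sub_eq_zero [TopologicalSpace.SeparableSpace E]
    (hE : IsReflexiveSpace 𝕜 E) (hC : ∀ γ, ‖ρ γ‖ ≤ C) {s : Finset (E →L[𝕜] E)}
    (hs : ∀ S ∈ s, IsLimitOperator ρ S) {x : E} (hx : ∑ S ∈ s, (S x - x) = 0) :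
    ∀ S ∈ s, S x = x := by
  classical
  let t := s.filter fun S => S x - x ≠ 0
  have ht : ∑ S ∈ t, (S x - x) = 0 := by rw [Finset.sum_filter_ne_zero, hx]
  rcases t.eq_empty_or_nonempty with h0 | hne
  · intro S hS
    by_contra h
    have : S ∈ t := Finset.mem_filter.2 ⟨hS, sub_ne_zero.2 h⟩
    simp [h0] at this
  exfalso
  -- The slice is taken smaller than the least nonzero displacement. As `ρ γ x` is the mean of the
  -- points `ρ γ (S x)` with `S ∈ t`, one of them lies in the slice, and its displacement is at most
  -- half the least one.
  obtain ⟨S₀, hS₀, hmin⟩ := t.exists_min_image (fun S => ‖S x - x‖) hne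
  have hpos : 0 < ‖S₀ x - x‖ := norm_pos_iff.2 (Finset.mem_filter.1 hS₀).2
  have hC1 : 0 < |C| + 1 := by positivity
  obtain ⟨γ, f, a, hγ, hsl⟩ := exists_slice_orbitHull hE hC x
    (show 0 < ‖S₀ x - x‖ / (2 * (|C| + 1)) by positivity)
  obtain ⟨S, hSt, hS⟩ : ∃ S ∈ t, a < RCLike.re (f (ρ γ (S x))) := by
    by_contra! h
    have h1 : ∑ S ∈ t, RCLike.re (f (ρ γ (S x - x))) = 0 := by
      rw [← map_sum, ← map_sum, ← map_sum, ht]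
      simp
    have h2 : ∑ S ∈ t, RCLike.re (f (ρ γ (S x - x))) < 0 := by
      refine Finset.sum_neg (fun S hS => ?_) hne
      rw [map_sub, map_sub, map_sub]
      linarith [h S hS]
    linarith
  have h1 := (hsl _ (map_mem_orbitHull
    ((hs S (Finset.mem_filter.1 hSt).1).map_mem_orbitHull x) γ) hS)
  rw [← map_sub] at h1
  have h2 : ‖S x - x‖ ≤ ‖S₀ x - x‖ / 2 := calc
    ‖S x - x‖ ≤ C * ‖ρ γ (S x - x)‖ := norm_le_mul_norm_map hC γ _
    _ ≤ (|C| + 1) * (‖S₀ x - x‖ / (2 * (|C| + 1))) :=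
        mul_le_mul ((le_abs_self C).trans (by linarith)) h1 (norm_nonneg _) hC1.le
    _ = ‖S₀ x - x‖ / 2 := by field_simp
  linarith [hmin S hSt]

end LimitOperators

/-! ### Common fixed points and the Alaoglu–Birkhoff decomposition -/

section FixedPoints

variable {𝕜 E Γ : Type*} [RCLike 𝕜] [NormedAddCommGroup E] [NormedSpace 𝕜 E] [Group Γ]

/-- The common fixed points of a set of operators. -/
def fixedSpace (𝒮 : Set (E →L[𝕜] E)) : Submodule 𝕜 E where
  carrier := {x | ∀ S ∈ 𝒮, S x = x}
  add_mem' hx hy S hS := by rw [map_add, hx S hS, hy S hS]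
  zero_mem' S _ := map_zero S
  smul_mem' c x hx S hS := by rw [map_smul, hx S hS]

/-- The closed linear span of the vectors `S x - x`, as the annihilator of the invariant
functionals. -/
def displacementSpace (𝒮 : Set (E →L[𝕜] E)) : Submodule 𝕜 E where
  carrier := {y | ∀ f : StrongDual 𝕜 E, (∀ S ∈ 𝒮, ∀ z, f (S z) = f z) → f y = 0}
  add_mem' hx hy f hf := by rw [map_add, hx f hf, hy f hf, add_zero]
  zero_mem' f _ := map_zero f
  smul_mem' c x hx f hf := by rw [map_smul, hx f hf, smul_zero]

theorem mem_fixedSpace {𝒮 : Set (E →L[𝕜] E)} {x : E} : x ∈ fixedSpace 𝒮 ↔ ∀ S ∈ 𝒮, S x = x :=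
  Iff.rfl

theorem mem_displacementSpace {𝒮 : Set (E →L[𝕜] E)} {y : E} : y ∈ displacementSpace 𝒮 ↔
    ∀ f : StrongDual 𝕜 E, (∀ S ∈ 𝒮, ∀ z, f (S z) = f z) → f y = 0 :=
  Iff.rfl

theorem isClosed_fixedSpace (𝒮 : Set (E →L[𝕜] E)) : IsClosed (fixedSpace 𝒮 : Set E) := by
  have : (fixedSpace 𝒮 : Set E) = ⋂ S ∈ 𝒮, {x | S x = x} := by
    ext x
    simp [mem_fixedSpace]
  rw [this]
  exact isClosed_biInter fun S _ => isClosed_eq S.continuous continuous_id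

theorem isClosed_displacementSpace (𝒮 : Set (E →L[𝕜] E)) :
    IsClosed (displacementSpace 𝒮 : Set E) := by
  have : (displacementSpace 𝒮 : Set E) =
      ⋂ f ∈ {f : StrongDual 𝕜 E | ∀ S ∈ 𝒮, ∀ z, f (S z) = f z}, {y | f y = 0} := by
    ext x
    simp [mem_displacementSpace]
  rw [this]
  exact isClosed_biInter fun f _ => isClosed_eq f.continuous continuous_const

/-- The points with orbit bounded by `r` on which all `𝒮`-invariant functionals agree with `x`. -/
def invariantSlab (ρ : Γ →* (E →L[𝕜] E)) (𝒮 : Set (E →L[𝕜] E)) (x : E) (r : ℝ) : Set E :=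
  {y | (∀ γ, ‖ρ γ y‖ ≤ r) ∧
    ∀ f : StrongDual 𝕜 E, (∀ S ∈ 𝒮, ∀ z, f (S z) = f z) → f y = f x}

variable {ρ : Γ →* (E →L[𝕜] E)} {𝒮 : Set (E →L[𝕜] E)} {x : E} {r C : ℝ}

theorem invariantSlab_closed {ι : Type*} {p : Filter ι} [p.NeBot] {a : E} {y : ι → E}
    (ha : WeakTendsto 𝕜 y p a) (hy : ∀ᶠ i in p, y i ∈ invariantSlab ρ 𝒮 x r) :
    a ∈ invariantSlab ρ 𝒮 x r :=
  ⟨fun γ => (ha.map (ρ γ)).norm_le (hy.mono fun _ hi => hi.1 γ), fun f hf =>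
    tendsto_nhds_unique (ha f) (tendsto_const_nhds.congr' (hy.mono fun _ hi => (hi.2 f hf).symm))⟩

theorem exists_weakTendsto_mem_invariantSlab (hE : IsReflexiveSpace 𝕜 E) {ι : Type*}
    (p : Ultrafilter ι) {y : ι → E} (hy : ∀ᶠ i in (p : Filter ι), y i ∈ invariantSlab ρ 𝒮 x r) :
    ∃ a ∈ invariantSlab ρ 𝒮 x r, WeakTendsto 𝕜 y p a := by
  obtain ⟨a, ha⟩ := hE.exists_weakTendsto p (hy.mono fun i hi => by simpa using hi.1 1)
  exact ⟨a, invariantSlab_closed ha hy, ha⟩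

theorem map_mem_invariantSlab {S : E →L[𝕜] E} (hS : IsLimitOperator ρ S) (hS𝒮 : S ∈ 𝒮) {y : E}
    (hy : y ∈ invariantSlab ρ 𝒮 x r) : S y ∈ invariantSlab ρ 𝒮 x r := by
  obtain ⟨p, hp⟩ := hS
  refine ⟨fun γ => ((hp y).map (ρ γ)).norm_le (Eventually.of_forall fun γ' => ?_),
    fun f hf => (hf S hS𝒮 y).trans (hy.2 f hf)⟩
  simpa using hy.1 (γ * γ')

theorem average_mem_invariantSlab {ι : Type*} {s : Finset ι} (hs : s.Nonempty) {y : ι → E}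
    (hy : ∀ i ∈ s, y i ∈ invariantSlab ρ 𝒮 x r) :
    (s.card : 𝕜)⁻¹ • ∑ i ∈ s, y i ∈ invariantSlab ρ 𝒮 x r := by
  have h0 : (s.card : 𝕜) ≠ 0 := Nat.cast_ne_zero.2 hs.card_ne_zero
  have h1 : (0 : ℝ) < s.card := Nat.cast_pos.2 hs.card_pos
  constructor
  · intro γ
    rw [map_smul, map_sum, norm_smul, norm_inv, RCLike.norm_natCast, inv_mul_le_iff₀ h1]
    simpa using norm_sum_le_of_le s fun i hi => (hy i hi).1 γ
  · intro f hf
    rw [map_smul, map_sum, Finset.sum_congr rfl fun i hi => (hy i hi).2 f hf]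
    simp [h0]

/-- Finitely many limit operators have a common fixed point in an invariant slab. -/
theorem exists_fixed_mem_invariantSlab_of_finite [TopologicalSpace.SeparableSpace E]
    (hE : IsReflexiveSpace 𝕜 E) (hC : ∀ γ, ‖ρ γ‖ ≤ C) (h𝒮 : ∀ S ∈ 𝒮, IsLimitOperator ρ S)
    (hx : x ∈ invariantSlab ρ 𝒮 x r) {s : Finset (E →L[𝕜] E)} (hs : ∀ S ∈ s, S ∈ 𝒮) :
    ∃ a ∈ invariantSlab ρ 𝒮 x r, ∀ S ∈ s, S a = a := by
  rcases s.eq_empty_or_nonempty with rfl | hne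
  · exact ⟨x, hx, by simp⟩
  have h0 : (s.card : 𝕜) ≠ 0 := Nat.cast_ne_zero.2 hne.card_ne_zero
  -- A weak limit of the Birkhoff averages of the mean operator is fixed by the mean, hence by each
  -- `S` through `fixed_of_sum_sub_eq_zero`.
  let A : E →L[𝕜] E := (s.card : 𝕜)⁻¹ • ∑ S ∈ s, S
  have hA : ∀ y, A y = (s.card : 𝕜)⁻¹ • ∑ S ∈ s, S y := fun y => by simp [A]
  have hAK : ∀ y ∈ invariantSlab ρ 𝒮 x r, A y ∈ invariantSlab ρ 𝒮 x r := fun y hy => by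
    rw [hA]
    exact average_mem_invariantSlab hne
      fun S hS => map_mem_invariantSlab (h𝒮 S (hs S hS)) (hs S hS) hy
  have hit : ∀ n : ℕ, A^[n] x ∈ invariantSlab ρ 𝒮 x r := fun n => by
    induction n with
    | zero => exact hx
    | succ n ih => rw [Function.iterate_succ_apply']; exact hAK _ ih
  obtain ⟨a, haK, ha⟩ := exists_weakTendsto_mem_invariantSlab hE (hyperfilter ℕ)
    (y := fun n => birkhoffAverage 𝕜 A id n x) (ρ := ρ) (𝒮 := 𝒮) (x := x) (r := r) <| by
      -- The average over no terms is 0 and may lie outside the slab, so `n = 0` is discarded.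
      refine Nat.hyperfilter_le_atTop ((eventually_gt_atTop 0).mono fun n hn => ?_)
      have := average_mem_invariantSlab (ρ := ρ) (𝒮 := 𝒮) (x := x) (r := r)
        (s := Finset.range n) (y := fun k => A^[k] x) (by simpa using hn.ne') fun k _ => hit k
      simpa [birkhoffAverage, birkhoffSum] using this
  have hlim : Tendsto (fun n => A (birkhoffAverage 𝕜 A id n x) - birkhoffAverage 𝕜 A id n x)
      (hyperfilter ℕ : Filter ℕ) (𝓝 0) := by
    have hb : Bornology.IsBounded (Set.range fun n => id (A^[n] x)) := by
      refine isBounded_iff_forall_norm_le.2 ⟨r, ?_⟩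
      rintro _ ⟨n, rfl⟩
      simpa using (hit n).1 1
    refine ((tendsto_birkhoffAverage_apply_sub_birkhoffAverage 𝕜 hb).mono_left
      Nat.hyperfilter_le_atTop).congr fun n => ?_
    congr 1
    simp only [birkhoffAverage, birkhoffSum, map_smul, map_sum, id,
      ← Function.iterate_succ_apply', ← Function.iterate_succ_apply]
  have hfix : A a - a = 0 := ((ha.map A).sub ha).eq (.of_tendsto hlim)
  refine ⟨a, haK, fixed_of_sum_sub_eq_zero hE hC (fun S hS => h𝒮 S (hs S hS)) ?_⟩
  have h1 := congrArg (fun z => (s.card : 𝕜) • z) (sub_eq_zero.1 hfix)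
  simp only [hA, smul_inv_smul₀ h0] at h1
  rw [Finset.sum_sub_distrib, h1]
  simp [Nat.cast_smul_eq_nsmul]

/-- Limit operators of a bounded group on a separable reflexive space have a common fixed point
which agrees with a given point on all invariant functionals. -/
theorem exists_mem_fixedSpace [TopologicalSpace.SeparableSpace E]
    (hE : IsReflexiveSpace 𝕜 E) (hC : ∀ γ, ‖ρ γ‖ ≤ C) (h𝒮 : ∀ S ∈ 𝒮, IsLimitOperator ρ S)
    (x : E) : ∃ a ∈ fixedSpace 𝒮, x - a ∈ displacementSpace 𝒮 := by
  classical
  have hx : x ∈ invariantSlab ρ 𝒮 x (C * ‖x‖) :=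
    ⟨fun γ => (ρ γ).le_of_opNorm_le (hC γ) x, fun f _ => rfl⟩
  have key : ∀ s : Finset 𝒮, ∃ a ∈ invariantSlab ρ 𝒮 x (C * ‖x‖), ∀ S ∈ s, S.1 a = a := by
    intro s
    obtain ⟨a, haK, ha⟩ := exists_fixed_mem_invariantSlab_of_finite hE hC h𝒮 hx
      (s := s.image Subtype.val) (by
        intro S hS
        obtain ⟨S', -, rfl⟩ := Finset.mem_image.1 hS
        exact S'.2)
    exact ⟨a, haK, fun S hS => ha S (Finset.mem_image_of_mem _ hS)⟩
  choose y hyK hy using key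
  -- Each `S` belongs to all sufficiently large finite sets, so it fixes `y s` eventually and
  -- therefore fixes the weak limit.
  let p : Ultrafilter (Finset 𝒮) := Ultrafilter.of atTop
  obtain ⟨a, haK, ha⟩ :=
    exists_weakTendsto_mem_invariantSlab hE p (Eventually.of_forall hyK)
  refine ⟨a, fun S hS => ?_, fun f hf => by rw [map_sub, haK.2 f hf, sub_self]⟩
  have hev : ∀ᶠ s in (p : Filter (Finset 𝒮)), S (y s) = y s :=
    Ultrafilter.of_le atTop ((eventually_ge_atTop {⟨S, hS⟩}).mono fun s hs =>
      hy s ⟨S, hS⟩ (hs (Finset.mem_singleton_self _)))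
  exact (ha.map S).eq fun f => (ha f).congr' (hev.mono fun s hs => by dsimp only; rw [hs])

/-- The transpose of an operator on the strong dual. -/
noncomputable def dualOperator (T : E →L[𝕜] E) : StrongDual 𝕜 E →L[𝕜] StrongDual 𝕜 E :=
  (ContinuousLinearMap.compL 𝕜 E E 𝕜).flip T

@[simp]
theorem dualOperator_apply (T : E →L[𝕜] E) (f : StrongDual 𝕜 E) (x : E) :
    dualOperator T f x = f (T x) :=
  rfl

theorem norm_dualOperator_le (T : E →L[𝕜] E) : ‖dualOperator T‖ ≤ ‖T‖ :=
  ContinuousLinearMap.opNorm_le_bound _ (norm_nonneg _) fun f => by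
    rw [mul_comm]
    exact ContinuousLinearMap.opNorm_comp_le f T

/-- The contragredient representation on the strong dual. -/
noncomputable def dualRepresentation (ρ : Γ →* (E →L[𝕜] E)) :
    Γ →* (StrongDual 𝕜 E →L[𝕜] StrongDual 𝕜 E) where
  toFun γ := dualOperator (ρ γ⁻¹)
  map_one' := by
    ext f x
    simp
  map_mul' γ γ' := by
    ext f x
    simp

/-- The contragredient involves inverses, so the ultrafilter is pushed forward by inversion; by
reflexivity it suffices to test on points of `E`. -/
theorem IsLimitOperator.dual (hE : IsReflexiveSpace 𝕜 E) {S : E →L[𝕜] E}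
    (hS : IsLimitOperator ρ S) : IsLimitOperator (dualRepresentation ρ) (dualOperator S) := by
  obtain ⟨p, hp⟩ := hS
  refine ⟨p.map Inv.inv, fun f φ => ?_⟩
  obtain ⟨x, rfl⟩ := hE φ
  rw [Ultrafilter.coe_map, tendsto_map'_iff]
  simpa [dualRepresentation, Function.comp_def, NormedSpace.dual_def] using hp x f

/-- **Alaoglu–Birkhoff decomposition** for limit operators of a bounded group on a separable
reflexive space. -/
theorem isCompl_fixedSpace_displacementSpace [TopologicalSpace.SeparableSpace E]
    (hE : IsReflexiveSpace 𝕜 E) (hC : ∀ γ, ‖ρ γ‖ ≤ C) (h𝒮 : ∀ S ∈ 𝒮, IsLimitOperator ρ S) :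
    IsCompl (fixedSpace 𝒮) (displacementSpace 𝒮) := by
  constructor
  · rw [Submodule.disjoint_def]
    intro x hxF hxD
    have : TopologicalSpace.SeparableSpace (StrongDual 𝕜 (StrongDual 𝕜 E)) :=
      hE.denseRange.separableSpace (NormedSpace.inclusionInDoubleDual 𝕜 E).continuous
    have : TopologicalSpace.SeparableSpace (StrongDual 𝕜 E) :=
      separableSpace_of_separableSpace_dual (𝕜 := 𝕜)
    refine (SeparatingDual.eq_zero_iff_forall_dual_eq_zero (R := 𝕜) x).2 fun f => ?_
    -- Split `f` on the dual side: the invariant part `g` kills `x` because `x` is a displacement,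
    -- and `f - g` kills `x` because evaluation at the fixed point `x` is invariant.
    obtain ⟨g, hgF, hgD⟩ := exists_mem_fixedSpace (ρ := dualRepresentation ρ)
      (𝒮 := dualOperator '' 𝒮) (C := C) hE.dual
      (fun γ => (norm_dualOperator_le _).trans (hC γ⁻¹))
      (by rintro _ ⟨S, hS, rfl⟩; exact (h𝒮 S hS).dual hE) f
    have h1 : g x = 0 := hxD g fun S hS z => by
      rw [← dualOperator_apply, hgF _ ⟨S, hS, rfl⟩]
    have h2 := hgD (NormedSpace.inclusionInDoubleDual 𝕜 E x) (by
      rintro _ ⟨S, hS, rfl⟩ h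
      simp only [NormedSpace.dual_def, dualOperator_apply, hxF S hS])
    rw [NormedSpace.dual_def, sub_apply, h1, sub_zero] at h2
    exact h2
  · rw [codisjoint_iff, eq_top_iff]
    intro x _
    obtain ⟨a, haF, haD⟩ := exists_mem_fixedSpace hE hC h𝒮 x
    exact Submodule.mem_sup.2 ⟨a, haF, x - a, haD, add_sub_cancel _ _⟩

end FixedPoints

/-! ### Limit operators along a conjugation-invariant filter -/

section FilterLimits

variable {𝕜 E Γ : Type*} [RCLike 𝕜] [NormedAddCommGroup E] [NormedSpace 𝕜 E] [Group Γ]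

/-- The limits, in the weak operator topology, of the operators `ρ γ` along ultrafilters finer
than `𝓕`. -/
def limitOperators (ρ : Γ →* (E →L[𝕜] E)) (𝓕 : Filter Γ) : Set (E →L[𝕜] E) :=
  {S | ∃ p : Ultrafilter Γ, ↑p ≤ 𝓕 ∧ ∀ x, WeakTendsto 𝕜 (fun γ => ρ γ x) p (S x)}

variable {ρ : Γ →* (E →L[𝕜] E)} {𝓕 : Filter Γ} {C : ℝ}

theorem isLimitOperator_of_mem_limitOperators {S : E →L[𝕜] E} (hS : S ∈ limitOperators ρ 𝓕) :
    IsLimitOperator ρ S := by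
  obtain ⟨p, -, hp⟩ := hS
  exact ⟨p, hp⟩

theorem map_inv_map (ρ : Γ →* (E →L[𝕜] E)) (g : Γ) (x : E) : ρ g⁻¹ (ρ g x) = x := by
  rw [← mul_apply_eq_comp, ← map_mul]
  simp

/-- The conjugated ultrafilter is again finer than `𝓕`. This is what makes the fixed and
displacement spaces invariant under the group. -/
theorem conj_mem_limitOperators {g : Γ} (hg : Tendsto (fun γ => g * γ * g⁻¹) 𝓕 𝓕)
    {S : E →L[𝕜] E} (hS : S ∈ limitOperators ρ 𝓕) : ρ g * S * ρ g⁻¹ ∈ limitOperators ρ 𝓕 := by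
  obtain ⟨p, hp𝓕, hp⟩ := hS
  refine ⟨p.map fun γ => g * γ * g⁻¹, (map_mono hp𝓕).trans hg, fun x f => ?_⟩
  rw [Ultrafilter.coe_map, tendsto_map'_iff]
  simpa [Function.comp_def] using (hp (ρ g⁻¹ x)).map (ρ g) f

theorem map_mem_fixedSpace (h𝓕 : ∀ g, Tendsto (fun γ => g * γ * g⁻¹) 𝓕 𝓕) (g : Γ) {x : E}
    (hx : x ∈ fixedSpace (limitOperators ρ 𝓕)) : ρ g x ∈ fixedSpace (limitOperators ρ 𝓕) := by
  intro S hS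
  have h := congrArg (ρ g) (hx _ (conj_mem_limitOperators (h𝓕 g⁻¹) hS))
  have h' := map_inv_map ρ g⁻¹ (S (ρ g x))
  rw [inv_inv] at h h'
  rw [← h']
  exact h

theorem map_mem_displacementSpace (h𝓕 : ∀ g, Tendsto (fun γ => g * γ * g⁻¹) 𝓕 𝓕) (g : Γ) {x : E}
    (hx : x ∈ displacementSpace (limitOperators ρ 𝓕)) :
    ρ g x ∈ displacementSpace (limitOperators ρ 𝓕) := by
  intro f hf
  refine hx (f.comp (ρ g)) fun S hS z => ?_
  have h := hf _ (conj_mem_limitOperators (h𝓕 g) hS) (ρ g z)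
  simp only [mul_apply_eq_comp, map_inv_map] at h
  exact h

/-- Bounded groups of operators on a reflexive space have limits along ultrafilters in the weak
operator topology. -/
theorem exists_limitOperator (hE : IsReflexiveSpace 𝕜 E) (hC : ∀ γ, ‖ρ γ‖ ≤ C)
    (p : Ultrafilter Γ) :
    ∃ S : E →L[𝕜] E, ∀ x, WeakTendsto 𝕜 (fun γ => ρ γ x) p (S x) := by
  have hb : ∀ x, ∀ᶠ γ in (p : Filter Γ), ‖ρ γ x‖ ≤ C * ‖x‖ := fun x =>
    Eventually.of_forall fun γ => (ρ γ).le_of_opNorm_le (hC γ) x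
  choose S hS using fun x => hE.exists_weakTendsto p (hb x)
  let L : E →ₗ[𝕜] E :=
    { toFun := S
      map_add' := fun x y => (hS (x + y)).eq fun f => by
        simpa using (hS x f).add (hS y f)
      map_smul' := fun c x => (hS (c • x)).eq fun f => by
        simpa using (hS x f).const_mul c }
  exact ⟨L.mkContinuous C fun x => (hS x).norm_le (hb x), hS⟩

/-- Each ultrafilter finer than `𝓕` has a limit operator, which must be the identity; this is weak
convergence, and on orbits it is norm convergence. -/
theorem tendsto_of_fixedSpace_eq_top [TopologicalSpace.SeparableSpace E]
    (hE : IsReflexiveSpace 𝕜 E) (hC : ∀ γ, ‖ρ γ‖ ≤ C)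
    (h : fixedSpace (limitOperators ρ 𝓕) = ⊤) (x : E) : Tendsto (fun γ => ρ γ x) 𝓕 (𝓝 x) := by
  refine WeakTendsto.tendsto_of_orbit hE hC (γ := id) fun f => ?_
  rw [tendsto_iff_ultrafilter]
  intro p hp
  obtain ⟨S, hS⟩ := exists_limitOperator hE hC p
  have hx : x ∈ fixedSpace (limitOperators ρ 𝓕) := h ▸ Submodule.mem_top
  have := hS x f
  rwa [hx S ⟨p, hp, hS⟩] at this

end FilterLimits

/-! ### The strong operator topology on bounded groups -/

section StrongTopology

variable {𝕜 E F : Type*} [RCLike 𝕜] [NormedAddCommGroup E] [NormedSpace 𝕜 E]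
  [NormedAddCommGroup F] [NormedSpace 𝕜 F]

/-- The uniform bound gives joint continuity of multiplication, and continuity of inversion through
S⁻¹ - a⁻¹ = S⁻¹ (a - S) a⁻¹. -/
theorem IsBoundedGroup.isSOTTopologicalGroup {G : Subgroup (E ≃L[𝕜] E)} (hG : IsBoundedGroup G) :
    IsSOTTopologicalGroup G := by
  obtain ⟨C, hC⟩ := hG
  have hle : ∀ (T : G) (x : E), ‖(T : E ≃L[𝕜] E) x‖ ≤ C * ‖x‖ := fun T x =>
    ((T : E ≃L[𝕜] E) : E →L[𝕜] E).le_of_opNorm_le (hC T T.2) x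
  let _ := sot G
  have hev : ∀ (x : E) (T : G), Tendsto (fun S : G => (S : E ≃L[𝕜] E) x) (𝓝 T)
      (𝓝 ((T : E ≃L[𝕜] E) x)) := fun x T => (tendsto_sot_iff G).1 tendsto_id x
  have hmul : ContinuousMul G := by
    refine ⟨continuous_iff_continuousAt.2 fun ⟨a, b⟩ => (tendsto_sot_iff G).2 fun x => ?_⟩
    have h1 : Tendsto (fun q : G × G => (q.1 : E ≃L[𝕜] E) ((b : E ≃L[𝕜] E) x)) (𝓝 (a, b))
        (𝓝 ((a : E ≃L[𝕜] E) ((b : E ≃L[𝕜] E) x))) :=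
      (hev _ a).comp (continuous_fst.tendsto (a, b))
    have h2 : Tendsto (fun q : G × G => (q.2 : E ≃L[𝕜] E) x) (𝓝 (a, b))
        (𝓝 ((b : E ≃L[𝕜] E) x)) := (hev _ b).comp (continuous_snd.tendsto (a, b))
    have h3 : Tendsto (fun q : G × G =>
        (q.1 : E ≃L[𝕜] E) ((q.2 : E ≃L[𝕜] E) x - (b : E ≃L[𝕜] E) x)) (𝓝 (a, b)) (𝓝 0) := by
      refine squeeze_zero_norm (fun q => hle q.1 _) ?_
      simpa using (h2.sub_const ((b : E ≃L[𝕜] E) x)).norm.const_mul C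
    have h4 := h3.add h1
    simp only [map_sub, sub_add_cancel, zero_add] at h4
    exact h4
  have hinv : ContinuousInv G := by
    refine ⟨continuous_iff_continuousAt.2 fun a => (tendsto_sot_iff G).2 fun x => ?_⟩
    rw [tendsto_iff_norm_sub_tendsto_zero]
    have h1 : Tendsto (fun S : G => C * ‖(a : E ≃L[𝕜] E) ((a⁻¹ : G).1 x)
        - (S : E ≃L[𝕜] E) ((a⁻¹ : G).1 x)‖) (𝓝 a) (𝓝 0) := by
      simpa using (((hev ((a⁻¹ : G).1 x) a).const_sub
        ((a : E ≃L[𝕜] E) ((a⁻¹ : G).1 x))).norm.const_mul C)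
    refine squeeze_zero (fun _ => norm_nonneg _) (fun S => ?_) h1
    have h2 : (S⁻¹ : G).1 x - (a⁻¹ : G).1 x = (S⁻¹ : G).1 ((a : E ≃L[𝕜] E) ((a⁻¹ : G).1 x)
        - (S : E ≃L[𝕜] E) ((a⁻¹ : G).1 x)) := by
      have e1 : (a : E ≃L[𝕜] E) ((a⁻¹ : G).1 x) = x := (a : E ≃L[𝕜] E).apply_symm_apply x
      have e2 : ∀ y, (S⁻¹ : G).1 ((S : E ≃L[𝕜] E) y) = y := (S : E ≃L[𝕜] E).symm_apply_apply
      rw [map_sub, e1, e2]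
    rw [h2]
    exact hle _ _
  exact { }

/-- An isomorphism of bounded groups which preserves convergence to the identity in both
directions is an isomorphism of topological groups. -/
theorem isSOTIsomorphism_of_tendsto {G : Subgroup (E ≃L[𝕜] E)} {H : Subgroup (F ≃L[𝕜] F)}
    (hG : IsBoundedGroup G) (hH : IsBoundedGroup H) (φ : G ≃* H)
    (h : ∀ p : Filter G, (∀ x, Tendsto (fun T : G => (T : E ≃L[𝕜] E) x) p (𝓝 x)) ↔
      ∀ y, Tendsto (fun T : G => (φ T : F ≃L[𝕜] F) y) p (𝓝 y)) :
    IsSOTIsomorphism φ := by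
  let _ := sot G
  let _ := sot H
  have : IsTopologicalGroup G := hG.isSOTTopologicalGroup
  have : IsTopologicalGroup H := hH.isSOTTopologicalGroup
  have h1 : Continuous φ := by
    refine continuous_of_continuousAt_one φ ?_
    rw [ContinuousAt, map_one]
    exact (tendsto_sot_iff H).2 ((h (𝓝 1)).1 ((tendsto_sot_iff G).1 tendsto_id))
  have h2 : Continuous φ.symm := by
    refine continuous_of_continuousAt_one φ.symm ?_
    rw [ContinuousAt, map_one]
    refine (tendsto_sot_iff G).2 ((h (map φ.symm (𝓝 1))).2 fun y => ?_)
    rw [tendsto_map'_iff]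
    simp only [Function.comp_def, MulEquiv.apply_symm_apply]
    exact (tendsto_sot_iff H).1 (tendsto_id (x := 𝓝 (1 : H))) y
  exact (Homeomorph.mk φ.toEquiv h1 h2).isHomeomorph

/-- The pullback along `θ` of the neighbourhoods of the identity in the strong operator
topology. -/
def sotComapOne {Γ : Type*} [Group Γ] (θ : Γ →* (F ≃L[𝕜] F)) : Filter Γ :=
  comap (fun γ y => θ γ y) (𝓝 fun y => y)

variable {Γ : Type*} [Group Γ] {θ : Γ →* (F ≃L[𝕜] F)}

theorem le_sotComapOne_iff {p : Filter Γ} :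
    p ≤ sotComapOne θ ↔ ∀ y, Tendsto (fun γ => θ γ y) p (𝓝 y) := by
  rw [sotComapOne, ← tendsto_iff_comap, tendsto_pi_nhds]

/-- An arbitrary filter along which `θ γ` tends to 1 need not be conjugation invariant, but it is
finer than this one, which is. -/
theorem tendsto_conj_sotComapOne (g : Γ) :
    Tendsto (fun γ => g * γ * g⁻¹) (sotComapOne θ) (sotComapOne θ) := by
  rw [Tendsto, le_sotComapOne_iff]
  intro y
  rw [tendsto_map'_iff]
  have h := ((θ g).continuous.tendsto _).comp (le_sotComapOne_iff (θ := θ).1 le_rfl ((θ g⁻¹) y))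
  have e : θ g (θ g⁻¹ y) = y := by
    rw [map_inv]
    exact (θ g).apply_symm_apply y
  rw [e] at h
  refine h.congr fun γ => ?_
  simp only [Function.comp_apply, map_mul]
  rfl

end StrongTopology

/-! ### Block decompositions and the two convergence criteria -/

section BlockGroups

variable {𝕜 X : Type*} [RCLike 𝕜] [NormedAddCommGroup X] [NormedSpace 𝕜 X]
  {Y Z : Submodule 𝕜 X}

theorem HasBlockForm.apply_left {T : X ≃L[𝕜] X} {u : Y ≃L[𝕜] Y} {w : Z →L[𝕜] Y} {v : Z ≃L[𝕜] Z}
    (h : HasBlockForm T u w v) (y : Y) : T y = u y := by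
  simpa using h y 0

theorem HasBlockForm.projectionOntoL_apply (hYZ : Y.IsTopCompl Z) {T : X ≃L[𝕜] X}
    {u : Y ≃L[𝕜] Y} {w : Z →L[𝕜] Y} {v : Z ≃L[𝕜] Z} (h : HasBlockForm T u w v) (x : X) :
    Z.projectionOntoL Y hYZ.symm (T x) = v (Z.projectionOntoL Y hYZ.symm x) := by
  obtain ⟨y, hy, z, hz, rfl⟩ := Submodule.mem_sup.1
    (hYZ.isCompl.sup_eq_top ▸ Submodule.mem_top : x ∈ Y ⊔ Z)
  lift y to Y using hy
  lift z to Z using hz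
  rw [h y z]
  simp

/-- An automorphism which maps `Y` onto itself has a block form. -/
theorem exists_hasBlockForm (hYZ : Y.IsTopCompl Z) (T : X ≃L[𝕜] X) (hT : ∀ x ∈ Y, T x ∈ Y)
    (hT' : ∀ x ∈ Y, T.symm x ∈ Y) : ∃ u w v, HasBlockForm (Y := Y) (Z := Z) T u w v := by
  let πY := Y.projectionOntoL Z hYZ
  let πZ := Z.projectionOntoL Y hYZ.symm
  have hsplit : ∀ x, (πY x : X) + πZ x = x := fun x => by
    simpa [πY, πZ] using Submodule.projection_add_projection_eq_self hYZ.isCompl x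
  -- The `Y`-component dropped by the inner `πZ` is sent into `Y` by `S'` and killed by the outer
  -- one, so the compressions to `Z` of `T` and its inverse are mutually inverse.
  have hkey : ∀ (S S' : X ≃L[𝕜] X), (∀ x ∈ Y, S' x ∈ Y) → (∀ x, S' (S x) = x) → ∀ z : Z,
      πZ (S' (πZ (S z))) = z := by
    intro S S' hS' hSS z
    have h1 : (πZ (S z) : X) = S z - πY (S z) := eq_sub_of_add_eq' (hsplit _)
    rw [h1, map_sub, map_sub, hSS]
    have h2 : πZ (S' (πY (S z))) = 0 := by
      simp [πZ, hS' _ (πY (S z)).2]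
    rw [h2]
    simp [πZ]
  let u : Y ≃L[𝕜] Y := ContinuousLinearEquiv.equivOfInverse
    (((T : X →L[𝕜] X).comp Y.subtypeL).codRestrict Y fun y => hT y y.2)
    (((T.symm : X →L[𝕜] X).comp Y.subtypeL).codRestrict Y fun y => hT' y y.2)
    (fun y => Subtype.ext (T.symm_apply_apply y)) (fun y => Subtype.ext (T.apply_symm_apply y))
  let v : Z ≃L[𝕜] Z := ContinuousLinearEquiv.equivOfInverse
    (πZ.comp ((T : X →L[𝕜] X).comp Z.subtypeL))
    (πZ.comp ((T.symm : X →L[𝕜] X).comp Z.subtypeL))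
    (fun z => hkey T T.symm hT' T.symm_apply_apply z)
    (fun z => hkey T.symm T hT T.apply_symm_apply z)
  refine ⟨u, πY.comp ((T : X →L[𝕜] X).comp Z.subtypeL), v, fun y z => ?_⟩
  rw [map_add, Submodule.coe_add, add_assoc]
  exact congrArg (T y + ·) (hsplit (T z)).symm

theorem isBoundedGroup_upperBlocks {G : Subgroup (X ≃L[𝕜] X)} (hG : IsBoundedGroup G) :
    IsBoundedGroup (upperBlocks Y Z G) := by
  obtain ⟨C, hC⟩ := hG
  refine ⟨C, ?_⟩
  rintro u ⟨v, w, T, hT, h⟩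
  refine ContinuousLinearMap.opNorm_le_bound _ ((norm_nonneg _).trans (hC T hT)) fun y => ?_
  have := (T : X →L[𝕜] X).le_of_opNorm_le (hC T hT) y
  rw [ContinuousLinearEquiv.coe_coe, h.apply_left] at this
  exact this

theorem isBoundedGroup_lowerBlocks (hYZ : Y.IsTopCompl Z) {G : Subgroup (X ≃L[𝕜] X)}
    (hG : IsBoundedGroup G) : IsBoundedGroup (lowerBlocks Y Z G) := by
  obtain ⟨C, hC⟩ := hG
  have hC0 : 0 ≤ C := (norm_nonneg _).trans (hC 1 G.one_mem)
  refine ⟨‖Z.projectionOntoL Y hYZ.symm‖ * C, ?_⟩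
  rintro v ⟨u, w, T, hT, h⟩
  refine ContinuousLinearMap.opNorm_le_bound _ (by positivity) fun z => ?_
  have h1 := h.projectionOntoL_apply hYZ z
  have h2 : Z.projectionOntoL Y hYZ.symm z = z := by simp
  rw [h2] at h1
  rw [ContinuousLinearEquiv.coe_coe, ← h1, mul_assoc]
  exact ContinuousLinearMap.le_opNorm_of_le _ ((T : X →L[𝕜] X).le_of_opNorm_le (hC T hT) z)

/-- The tautological representation of a group of automorphisms. -/
def tautologicalRepresentation (G : Subgroup (X ≃L[𝕜] X)) : G →* (X →L[𝕜] X) where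
  toFun T := ((T : X ≃L[𝕜] X) : X →L[𝕜] X)
  map_one' := rfl
  map_mul' _ _ := rfl

variable [TopologicalSpace.SeparableSpace X] {G : Subgroup (X ≃L[𝕜] X)}

/-- If `Y` is a maximal closed invariant subspace without invariant complement, then convergence
to the identity on `Y`, along a conjugation invariant filter, is convergence to the identity. -/
theorem tendsto_of_tendsto_on (hrefl : IsReflexiveSpace 𝕜 X) (hG : IsBoundedGroup G)
    (hsuper : ¬ ∃ W : Submodule 𝕜 X, IsClosed (W : Set X) ∧ IsInvariantUnder G W ∧ Y < W ∧ W < ⊤)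
    (hcompl : ¬ ∃ W : Submodule 𝕜 X, IsClosed (W : Set X) ∧ IsInvariantUnder G W ∧ IsCompl Y W)
    {𝓕 : Filter G} (h𝓕 : ∀ g, Tendsto (fun γ => g * γ * g⁻¹) 𝓕 𝓕)
    (hY : ∀ y ∈ Y, Tendsto (fun T : G => (T : X ≃L[𝕜] X) y) 𝓕 (𝓝 y)) (x : X) :
    Tendsto (fun T : G => (T : X ≃L[𝕜] X) x) 𝓕 (𝓝 x) := by
  obtain ⟨C, hC⟩ := hG
  let ρ := tautologicalRepresentation G
  have hρ : ∀ γ, ‖ρ γ‖ ≤ C := fun γ => hC γ γ.2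
  have hcom := isCompl_fixedSpace_displacementSpace hrefl hρ
    (fun S (hS : S ∈ limitOperators ρ 𝓕) => isLimitOperator_of_mem_limitOperators hS)
  have hle : Y ≤ fixedSpace (limitOperators ρ 𝓕) := by
    rintro y hy S ⟨p, hp, hS⟩
    exact (hS y).eq (.of_tendsto ((hY y hy).mono_left hp))
  refine tendsto_of_fixedSpace_eq_top hrefl hρ ?_ x
  by_contra hne
  rcases hle.eq_or_lt with heq | hlt
  · rw [← heq] at hcom
    exact hcompl ⟨_, isClosed_displacementSpace _,
      fun T hT x hx => map_mem_displacementSpace h𝓕 ⟨T, hT⟩ hx, hcom⟩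
  · exact hsuper ⟨_, isClosed_fixedSpace _,
      fun T hT x hx => map_mem_fixedSpace h𝓕 ⟨T, hT⟩ hx, hlt, lt_top_iff_ne_top.2 hne⟩

/-- If `Y` is a minimal closed invariant subspace without invariant complement, then convergence
to the identity modulo `Y`, along a conjugation invariant filter, is convergence to the
identity. -/
theorem tendsto_of_tendsto_modulo (hrefl : IsReflexiveSpace 𝕜 X) (hYZ : Y.IsTopCompl Z)
    (hG : IsBoundedGroup G)
    (hsub : ¬ ∃ W : Submodule 𝕜 X, IsClosed (W : Set X) ∧ IsInvariantUnder G W ∧ ⊥ < W ∧ W < Y)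
    (hcompl : ¬ ∃ W : Submodule 𝕜 X, IsClosed (W : Set X) ∧ IsInvariantUnder G W ∧ IsCompl Y W)
    {𝓕 : Filter G} (h𝓕 : ∀ g, Tendsto (fun γ => g * γ * g⁻¹) 𝓕 𝓕)
    (hZ : ∀ x, Tendsto (fun T : G => Z.projectionOntoL Y hYZ.symm ((T : X ≃L[𝕜] X) x)) 𝓕
      (𝓝 (Z.projectionOntoL Y hYZ.symm x))) (x : X) :
    Tendsto (fun T : G => (T : X ≃L[𝕜] X) x) 𝓕 (𝓝 x) := by
  obtain ⟨C, hC⟩ := hG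
  let ρ := tautologicalRepresentation G
  have hρ : ∀ γ, ‖ρ γ‖ ≤ C := fun γ => hC γ γ.2
  have hcom := isCompl_fixedSpace_displacementSpace hrefl hρ
    (fun S (hS : S ∈ limitOperators ρ 𝓕) => isLimitOperator_of_mem_limitOperators hS)
  have hle : displacementSpace (limitOperators ρ 𝓕) ≤ Y := by
    intro y hy
    -- Functionals factoring through the projection onto `Z` are invariant under the limit
    -- operators, so they vanish on displacements.
    have h0 : Z.projectionOntoL Y hYZ.symm y = 0 := by
      refine (SeparatingDual.eq_zero_iff_forall_dual_eq_zero (R := 𝕜) _).2 fun f => ?_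
      refine hy (f.comp (Z.projectionOntoL Y hYZ.symm)) ?_
      rintro S ⟨p, hp, hS⟩ z
      exact congrArg f (((hS z).map (Z.projectionOntoL Y hYZ.symm)).eq
        (.of_tendsto ((hZ z).mono_left hp)))
    simpa using h0
  refine tendsto_of_fixedSpace_eq_top hrefl hρ ?_ x
  rcases hle.eq_or_lt with heq | hlt
  · rw [heq] at hcom
    exact (hcompl ⟨_, isClosed_fixedSpace _,
      fun T hT x hx => map_mem_fixedSpace h𝓕 ⟨T, hT⟩ hx, hcom.symm⟩).elim
  · by_contra hne
    refine hsub ⟨_, isClosed_displacementSpace _,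
      fun T hT x hx => map_mem_displacementSpace h𝓕 ⟨T, hT⟩ hx, bot_lt_iff_ne_bot.2 ?_, hlt⟩
    intro h0
    rw [h0] at hcom
    exact hne (by simpa using hcom.sup_eq_top)

end BlockGroups

end BlockSOT

theorem mainTheorem2 {𝕜 X : Type*} [RCLike 𝕜] [NormedAddCommGroup X] [NormedSpace 𝕜 X]
    [CompleteSpace X] [TopologicalSpace.SeparableSpace X]
    (hrefl : BlockSOT.IsReflexiveSpace 𝕜 X)
    (Y Z : Submodule 𝕜 X) (hY : IsClosed (Y : Set X)) (hZ : IsClosed (Z : Set X))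
    (hYZ : IsCompl Y Z)
    (G : Subgroup (X ≃L[𝕜] X)) (hG : BlockSOT.IsBoundedGroup G)
    (hGY : BlockSOT.IsInvariantUnder G Y)
    (hsub : ¬ ∃ W : Submodule 𝕜 X, IsClosed (W : Set X) ∧ BlockSOT.IsInvariantUnder G W ∧
      ⊥ < W ∧ W < Y)
    (hsuper : ¬ ∃ W : Submodule 𝕜 X, IsClosed (W : Set X) ∧ BlockSOT.IsInvariantUnder G W ∧
      Y < W ∧ W < ⊤)
    (hcompl : ¬ ∃ W : Submodule 𝕜 X, IsClosed (W : Set X) ∧ BlockSOT.IsInvariantUnder G W ∧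
      IsCompl Y W) :
    BlockSOT.IsSOTTopologicalGroup G ∧
    BlockSOT.IsSOTTopologicalGroup (BlockSOT.upperBlocks Y Z G) ∧
    BlockSOT.IsSOTTopologicalGroup (BlockSOT.lowerBlocks Y Z G) ∧
    ∃ (δ : (Y ≃L[𝕜] Y) → (Z ≃L[𝕜] Z) → (Z →L[𝕜] Y))
      (φ : G ≃* BlockSOT.upperBlocks Y Z G) (ψ : G ≃* BlockSOT.lowerBlocks Y Z G),
      (∀ T : G, BlockSOT.HasBlockForm (T : X ≃L[𝕜] X) (φ T : Y ≃L[𝕜] Y)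
        (δ (φ T) (ψ T)) (ψ T : Z ≃L[𝕜] Z)) ∧
      BlockSOT.IsSOTIsomorphism φ ∧ BlockSOT.IsSOTIsomorphism ψ := by
  have htop : Y.IsTopCompl Z := Submodule.IsCompl.isTopCompl_of_isClosed hYZ hY hZ
  have hU := BlockSOT.isBoundedGroup_upperBlocks (Z := Z) (Y := Y) hG
  have hV := BlockSOT.isBoundedGroup_lowerBlocks htop hG
  refine ⟨hG.isSOTTopologicalGroup, hU.isSOTTopologicalGroup, hV.isSOTTopologicalGroup, ?_⟩
  choose u w v huv using fun T : G => BlockSOT.exists_hasBlockForm htop (T : X ≃L[𝕜] X)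
    (hGY T T.2) (hGY (T : X ≃L[𝕜] X)⁻¹ (G.inv_mem T.2))
  have huniq : ∀ (T : G) {u' : Y ≃L[𝕜] Y} {w' : Z →L[𝕜] Y} {v' : Z ≃L[𝕜] Z},
      BlockSOT.HasBlockForm (T : X ≃L[𝕜] X) u' w' v' → u T = u' ∧ w T = w' ∧ v T = v' :=
    fun T _ _ _ h => (huv T).unique hYZ h
  let φ₀ : G →* (Y ≃L[𝕜] Y) :=
    { toFun := u
      map_one' := (huniq 1 BlockSOT.HasBlockForm.one).1
      map_mul' := fun S T => (huniq (S * T) ((huv S).mul (huv T))).1 }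
  let ψ₀ : G →* (Z ≃L[𝕜] Z) :=
    { toFun := v
      map_one' := (huniq 1 BlockSOT.HasBlockForm.one).2.2
      map_mul' := fun S T => (huniq (S * T) ((huv S).mul (huv T))).2.2 }
  have hφ : ∀ p : Filter G, (∀ x, Tendsto (fun T : G => (T : X ≃L[𝕜] X) x) p (𝓝 x)) ↔
      ∀ y, Tendsto (fun T => φ₀ T y) p (𝓝 y) := by
    refine fun p => ⟨fun h y => ?_, fun h x => ?_⟩
    · rw [tendsto_subtype_rng]
      exact (h y).congr fun T => (huv T).apply_left y
    · refine (BlockSOT.tendsto_of_tendsto_on hrefl hG hsuper hcompl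
        (BlockSOT.tendsto_conj_sotComapOne (θ := φ₀)) (fun y hy => ?_) x).mono_left
        (BlockSOT.le_sotComapOne_iff.2 h)
      have h1 := tendsto_subtype_rng.1
        (BlockSOT.le_sotComapOne_iff (θ := φ₀).1 le_rfl (⟨y, hy⟩ : Y))
      exact h1.congr fun T => ((huv T).apply_left ⟨y, hy⟩).symm
  have hψ : ∀ p : Filter G, (∀ x, Tendsto (fun T : G => (T : X ≃L[𝕜] X) x) p (𝓝 x)) ↔
      ∀ z, Tendsto (fun T => ψ₀ T z) p (𝓝 z) := by
    refine fun p => ⟨fun h z => ?_, fun h x => ?_⟩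
    · have h1 := ((Z.projectionOntoL Y htop.symm).continuous.tendsto _).comp (h z)
      rw [Submodule.projectionOntoL_apply_left] at h1
      refine h1.congr fun T => ?_
      rw [Function.comp_apply, (huv T).projectionOntoL_apply htop,
        Submodule.projectionOntoL_apply_left]
      rfl
    · refine (BlockSOT.tendsto_of_tendsto_modulo hrefl htop hG hsub hcompl
        (BlockSOT.tendsto_conj_sotComapOne (θ := ψ₀)) (fun x => ?_) x).mono_left
        (BlockSOT.le_sotComapOne_iff.2 h)
      exact (BlockSOT.le_sotComapOne_iff (θ := ψ₀).1 le_rfl _).congr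
        fun T => ((huv T).projectionOntoL_apply htop x).symm
  -- Convergence to the identity along `pure T` means T = 1, so `hφ` and `hψ` on principal filters
  -- give trivial kernels.
  have hone : ∀ T : G, (∀ x, Tendsto (fun S : G => (S : X ≃L[𝕜] X) x) (pure T) (𝓝 x)) → T = 1 :=
    fun T h => Subtype.ext <| ContinuousLinearEquiv.ext <| funext fun x =>
      tendsto_nhds_unique (tendsto_pure_nhds (fun S : G => (S : X ≃L[𝕜] X) x) T) (h x)
  have hφinj : Function.Injective φ₀ := (injective_iff_map_eq_one φ₀).2 fun T hT =>
    hone T ((hφ _).2 fun y => by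
      have h := tendsto_pure_nhds (fun S => φ₀ S y) T
      rw [hT] at h
      exact h)
  have hψinj : Function.Injective ψ₀ := (injective_iff_map_eq_one ψ₀).2 fun T hT =>
    hone T ((hψ _).2 fun z => by
      have h := tendsto_pure_nhds (fun S => ψ₀ S z) T
      rw [hT] at h
      exact h)
  let φ : G ≃* BlockSOT.upperBlocks Y Z G := MulEquiv.ofBijective
    (φ₀.codRestrict (BlockSOT.upperBlocks Y Z G) fun T => ⟨v T, w T, T, T.2, huv T⟩)
    ⟨fun S T h => hφinj (congrArg Subtype.val h), by
      rintro ⟨u', v', w', T, hT, h⟩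
      exact ⟨⟨T, hT⟩, Subtype.ext (huniq ⟨T, hT⟩ h).1⟩⟩
  let ψ : G ≃* BlockSOT.lowerBlocks Y Z G := MulEquiv.ofBijective
    (ψ₀.codRestrict (BlockSOT.lowerBlocks Y Z G) fun T => ⟨u T, w T, T, T.2, huv T⟩)
    ⟨fun S T h => hψinj (congrArg Subtype.val h), by
      rintro ⟨v', u', w', T, hT, h⟩
      exact ⟨⟨T, hT⟩, Subtype.ext (huniq ⟨T, hT⟩ h).2.2⟩⟩
  -- As `φ₀` is injective, `u` alone determines the corner entry; off the range of `φ₀` the value of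
  -- `δ` is arbitrary.
  refine ⟨fun u' _ => w (Function.invFun φ₀ u'), φ, ψ, fun T => ?_,
    BlockSOT.isSOTIsomorphism_of_tendsto hG hU φ hφ,
    BlockSOT.isSOTIsomorphism_of_tendsto hG hV ψ hψ⟩
  have h : Function.invFun φ₀ (φ T : Y ≃L[𝕜] Y) = T := Function.leftInverse_invFun hφinj T
  simp only [h]
  exact huv T
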